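/- Let $n\ge 1$, let $I\subset[0,\infty)$ be an interval with more than one point and $0\in I$, let $\lambda:I\to(0,\infty)$ be differentiable, put $\tau(t)=\int_0^t\lambda(s)^{-2}\,ds$ and $J=\tau(I)$, and let $t(\tau)$ be the inverse function. Let $z:I\to\mathbb R^{n+1}$ be such that $\tau\mapsto z(t(\tau))$ is $C^1$ on $J$. Write $z_\tau=\frac{\partial}{\partial\tau}z(t(\tau))$ and $a=-\lambda\dot\lambda$ with $\dot\lambda=d\lambda/dt$; $\lambda$ and $a$ are taken at $t=t(\tau)$. Let $\rho(\omega,\tau)>0$, $\omega\in S^n$ (the unit sphere in $\mathbb R^{n+1}$), $\tau\in J$, be $C^2$ in $\omega$ and differentiable in $\tau$, and let $\tilde M_\tau$ be the closed hypersurface given by the immersion $y(\omega,\tau)=\rho(\omega,\tau)\,\omega$ of $S^n$. Then $\tilde M_\tau$ satisfies the rescaled mean curvature flow equation $$\frac{\partial y}{\partial\tau}=-H(y)\,\nu(y)+a\,y-\lambda^{-1}z_\tau \qquad(\tau\in J)$$ up to tangential velocities if and only if $\rho$ satisfies, on $S^n\times J$, $$\frac{\partial\rho}{\partial\tau}=G(\rho)+a\rho-\lambda^{-1}z_\tau\cdot\omega+\lambda^{-1}\,\tilde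 z_\tau\cdot\frac{\nabla\rho}{\rho},$$ $$G(\rho)=\frac{1}{\rho^2}\Delta\rho-\frac n\rho-\frac{\nabla\rho\cdot\mathrm{Hess}(\rho)\nabla\rho}{\rho^2(\rho^2+|\nabla\rho|^2)}-\frac{|\nabla\rho|^2}{\rho(\rho^2+|\nabla\rho|^2)}.$$ Here $\nu$ is the outward unit normal and $H$ the mean curvature (the sum of the principal curvatures, equal to $n/R$ on a sphere of radius $R$) of $\tilde M_\tau$. "Up to tangential velocities" means that at each point the two sides of the flow equation differ by a vector tangent to $\tilde M_\tau$, i.e. their normal components agree, so that the equation describes the moving surface and not a particular parametrization of it. In local coordinates $u$ of $S^n$, with parametrization $x=x(u)$ and standard metric $g_{ij}=\partial_ix\cdot\partial_jx$, one has $\nabla^k\rho=g^{km}\partial_m\rho$, $(\mathrm{Hess}\,\rho)_{ij}=\partial_i\partial_j\rho-\Gamma_{ij}^k\partial_k\rho$, $\Delta\rho=g^{ij}(\mathrm{Hess}\,\rho)_{ij}$, $|\nabla\rho|^2=g_{ij}\nabla^i\rho\nabla^j\rho$, $\nabla\rho\cdot\mathrm{Hess}(\rho)\nabla\rho=(\mathrm{Hess}\,\rho)_{ij}\nabla^i\rho\nabla^j\rho$,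 and $\tilde z_\tau\cdot\nabla\rho=\tilde z_{\tau k}\nabla^k\rho$ with $\tilde z_{\tau k}=\partial_kx\cdot z_\tau$. -/

import Mathlib

open scoped Manifold ContDiff RealInnerProductSpace Topology

noncomputable section

namespace RescaledMCF

/-- `ℝᵈ` with its Euclidean structure. -/
abbrev E (d : ℕ) : Type := EuclideanSpace ℝ (Fin d)

/-- The unit sphere `Sⁿ ⊂ ℝⁿ⁺¹`, centered at the origin. -/
abbrev S (n : ℕ) : Type := Metric.sphere (0 : E (n + 1)) 1

/-- The smooth charts of `Sⁿ`. The inverse `x = e.symm`, on `e.target`, of such a chart `e` is a local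
parametrization `x = x(u)` of `Sⁿ`. -/
def charts (n : ℕ) : Set (OpenPartialHomeomorph (S n) (E n)) :=
  IsManifold.maximalAtlas (𝓡 n) ∞ (S n)

/-- The local parametrization `x = x(u)` of `Sⁿ`, as a map into `ℝⁿ⁺¹`. -/
def param {n : ℕ} (e : OpenPartialHomeomorph (S n) (E n)) (u : E n) : E (n + 1) :=
  (e.symm u : E (n + 1))

/-! ### Calculus in a local parametrization -/

section Local

variable {n : ℕ} {V : Type*} [NormedAddCommGroup V] [NormedSpace ℝ V]

/-- The partial derivative `∂f/∂uⁱ`. -/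
def pd (i : Fin n) (f : E n → V) (u : E n) : V :=
  fderiv ℝ f u (EuclideanSpace.single i 1)

/-- The induced metric (first fundamental form) `g_{ij} = ∂_i F · ∂_j F` of a local parametrization
`F` of a hypersurface. -/
def metric (F : E n → E (n + 1)) (u : E n) : Matrix (Fin n) (Fin n) ℝ :=
  Matrix.of fun i j => ⟪pd i F u, pd j F u⟫

/-- The inverse metric `g^{ij}`. -/
def invMetric (F : E n → E (n + 1)) (u : E n) : Matrix (Fin n) (Fin n) ℝ :=
  (metric F u)⁻¹

/-- The Christoffel symbols
`Γ_{ij}^k = ½ g^{km} (∂_j g_{im} + ∂_i g_{jm} - ∂_m g_{ij})`. -/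
def christoffel (F : E n → E (n + 1)) (u : E n) (i j k : Fin n) : ℝ :=
  (1 / 2) * ∑ m, invMetric F u k m *
    (pd j (fun v => metric F v i m) u + pd i (fun v => metric F v j m) u
      - pd m (fun v => metric F v i j) u)

/-- The components `∇^k f = g^{km} ∂_m f` of the gradient. -/
def grad (F : E n → E (n + 1)) (f : E n → ℝ) (u : E n) (k : Fin n) : ℝ :=
  ∑ m, invMetric F u k m * pd m f u

/-- The Hessian `(Hess f)_{ij} = ∂_i ∂_j f - Γ_{ij}^k ∂_k f`. -/
def hess (F : E n → E (n + 1)) (f : E n → ℝ) (u : E n) (i j : Fin n) : ℝ :=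
  pd i (pd j f) u - ∑ k, christoffel F u i j k * pd k f u

/-- The Laplace–Beltrami operator `Δ f = g^{ij} (Hess f)_{ij}`. -/
def laplacian (F : E n → E (n + 1)) (f : E n → ℝ) (u : E n) : ℝ :=
  ∑ i, ∑ j, invMetric F u i j * hess F f u i j

/-- `|∇f|² = g_{ij} ∇^i f ∇^j f`. -/
def gradNormSq (F : E n → E (n + 1)) (f : E n → ℝ) (u : E n) : ℝ :=
  ∑ i, ∑ j, metric F u i j * grad F f u i * grad F f u j

/-- `∇f · Hess(f) ∇f = (Hess f)_{ij} ∇^i f ∇^j f`. -/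
def gradHessGrad (F : E n → E (n + 1)) (f : E n → ℝ) (u : E n) : ℝ :=
  ∑ i, ∑ j, hess F f u i j * grad F f u i * grad F f u j

/-- The mean curvature `H = g^{ij} h_{ij}`, `h_{ij} = -∂_i ∂_j F · ν`, with respect to the unit normal
`ν` (the sum of the principal curvatures, equal to `n / R` on the sphere of radius `R` with its outward
normal). -/
def meanCurvature (F : E n → E (n + 1)) (ν : E (n + 1)) (u : E n) : ℝ :=
  ∑ i, ∑ j, invMetric F u i j * (-⟪pd i (pd j F) u, ν⟫)

/-- `ν` is the outward unit normal, at the point `F u`, of the closed hypersurface `M` with local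
parametrization `F`: it is a unit vector, orthogonal to the tangent space, and it points into the
unbounded part of the complement of `M`. -/
def IsOutwardUnitNormal (M : Set (E (n + 1))) (F : E n → E (n + 1)) (u : E n)
    (ν : E (n + 1)) : Prop :=
  ‖ν‖ = 1 ∧ (∀ i, ⟪pd i F u, ν⟫ = 0) ∧
    ∀ᶠ s : ℝ in 𝓝[>] 0, ¬ Bornology.IsBounded (connectedComponentIn Mᶜ (F u + s • ν))

/-- The operator `G(f)`, in a local parametrization `F` of `Sⁿ`. -/
def G (F : E n → E (n + 1)) (f : E n → ℝ) (u : E n) : ℝ :=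
  laplacian F f u / f u ^ 2 - n / f u
    - gradHessGrad F f u / (f u ^ 2 * (f u ^ 2 + gradNormSq F f u))
    - gradNormSq F f u / (f u * (f u ^ 2 + gradNormSq F f u))

end Local

/-! ### Rescaled time -/

/-- The rescaled time `τ(t) = ∫₀ᵗ λ(s)⁻² ds`. -/
def rescaledTime (lam : ℝ → ℝ) (t : ℝ) : ℝ := ∫ s in (0 : ℝ)..t, ((lam s) ^ 2)⁻¹

/-- The interval that `τ` runs through when `t` runs through `I`. -/
def rescaledInterval (I : Set ℝ) (lam : ℝ → ℝ) : Set ℝ := rescaledTime lam '' I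

/-- The inverse function `t(τ)` of `τ(t)`, `t ∈ I`. -/
def originalTime (I : Set ℝ) (lam : ℝ → ℝ) (τ : ℝ) : ℝ :=
  Function.invFunOn (rescaledTime lam) I τ

/-- `a = -λ λ̇`, where the dot is the `t`-derivative, as a function of `τ`. -/
def aCoeff (I : Set ℝ) (lam : ℝ → ℝ) (τ : ℝ) : ℝ :=
  -(lam (originalTime I lam τ) * derivWithin lam I (originalTime I lam τ))

/-- `z_τ = ∂z/∂τ`, the `τ`-derivative of `z(t(τ))`. -/
def zTau (I : Set ℝ) (lam : ℝ → ℝ) {n : ℕ} (z : ℝ → E (n + 1)) (τ : ℝ) : E (n + 1) :=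
  derivWithin (fun σ => z (originalTime I lam σ)) (rescaledInterval I lam) τ

/-! ### The two equations -/

/-- The family of closed hypersurfaces `y(Sⁿ, τ)` evolves by the rescaled mean curvature flow
`∂y/∂τ = -H(y) ν(y) + a y - λ⁻¹ z_τ`, `a = -λ λ̇`. This is an equation for the moving surface, not for a
particular parametrization of it, so it is required up to a tangential velocity: a point `y(u(τ), τ)` of
the moving surface has the velocity `∂y/∂τ + cⁱ ∂y/∂uⁱ`, `c = du/dτ`, and `c` is free. Equivalently, the
normal components of both sides agree at all points. -/
def SatisfiesRescaledMCF {n : ℕ} (I : Set ℝ) (lam : ℝ → ℝ) (z : ℝ → E (n + 1))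
    (y : S n → ℝ → E (n + 1)) : Prop :=
  ∀ τ ∈ rescaledInterval I lam, ∀ e ∈ charts n, ∀ u ∈ e.target,
    ∃ (ν : E (n + 1)) (c : Fin n → ℝ),
      IsOutwardUnitNormal (Set.range fun p => y p τ) (fun v => y (e.symm v) τ) u ν ∧
      derivWithin (y (e.symm u)) (rescaledInterval I lam) τ
          + ∑ i, c i • pd i (fun v => y (e.symm v) τ) u =
        -(meanCurvature (fun v => y (e.symm v) τ) ν u • ν)
          + aCoeff I lam τ • y (e.symm u) τ
          - (lam (originalTime I lam τ))⁻¹ • zTau I lam z τ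

/-- The scalar equation
`∂ρ/∂τ = G(ρ) + a ρ - λ⁻¹ z_τ · ω + λ⁻¹ z̃_τ · ∇ρ / ρ`, with `z̃_{τ k} = (∂xⁱ/∂uᵏ) z_τⁱ`, on `Sⁿ`. -/
def SatisfiesGraphEquation {n : ℕ} (I : Set ℝ) (lam : ℝ → ℝ) (z : ℝ → E (n + 1))
    (ρ : S n → ℝ → ℝ) : Prop :=
  ∀ τ ∈ rescaledInterval I lam, ∀ e ∈ charts n, ∀ u ∈ e.target,
    derivWithin (ρ (e.symm u)) (rescaledInterval I lam) τ =
      G (param e) (fun v => ρ (e.symm v) τ) u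
        + aCoeff I lam τ * ρ (e.symm u) τ
        - (lam (originalTime I lam τ))⁻¹ * ⟪zTau I lam z τ, param e u⟫
        + (lam (originalTime I lam τ))⁻¹ *
            ((∑ k, ⟪pd k (param e) u, zTau I lam z τ⟫
              * grad (param e) (fun v => ρ (e.symm v) τ) u k) / ρ (e.symm u) τ)

end RescaledMCF

end

/-! Fix `τ` and a point of the sphere. Since the tangential velocity is free, the flow equation says
only that both sides have the same inner product with `ν`. Write `W = ρ² + |∇ρ|²`. The radial graph
`ρ ω` has normal `ν = (ρ ω - ∇ρ) / √W`, so `ω · ν = ρ / √W` and `z_τ · ν = (ρ z_τ · ω - z_τ · ∇ρ) /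
√W`, while `meanCurvature_graph` gives `H = -ρ G(ρ) / √W`. Dividing the normal equation by the
positive factor `ρ / √W` yields the scalar equation; this is `exists_tangential_velocity_iff`.

The curvature formula rests on two facts: the induced metric `ρ² g + dρ ⊗ dρ` is a rank-one
perturbation, inverted explicitly in `invMetric_graph`, and the second derivatives of the graph pair
with `ρ ω - ∇ρ` to give the Hessian, by `inner_pd_pd_graph_graphNormalVec`.

The remaining point is topological. Outwardness is defined by unbounded components of the
complement, and `isOutwardUnitNormal_iff` shows that it selects exactly the `ν` above: a line in the
direction `ν` crosses from the bounded star-shaped region to the unbounded one. -/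

noncomputable section

namespace RescaledMCF

/-! ### Radial projection and smooth charts of the sphere -/

section Sphere

variable {n : ℕ}

/-- The radial projection `p ↦ p / |p|` onto the sphere, with an arbitrary value at the origin. -/
def radialProj (p : E (n + 1)) : S n :=
  if h : p = 0 then ⟨EuclideanSpace.single 0 1, by simp⟩
  else ⟨‖p‖⁻¹ • p, by simp [norm_smul, h]⟩

theorem coe_radialProj {p : E (n + 1)} (h : p ≠ 0) : (radialProj p : E (n + 1)) = ‖p‖⁻¹ • p := by
  simp [radialProj, h]

theorem norm_smul_radialProj (p : E (n + 1)) : ‖p‖ • (radialProj p : E (n + 1)) = p := by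
  by_cases h : p = 0
  · simp [h]
  · rw [coe_radialProj h, smul_smul, mul_inv_cancel₀ (norm_ne_zero_iff.2 h), one_smul]

theorem norm_coe_sphere (x : S n) : ‖(x : E (n + 1))‖ = 1 := by simp

theorem coe_sphere_ne_zero (x : S n) : (x : E (n + 1)) ≠ 0 := by
  rw [← norm_ne_zero_iff]; simp

theorem radialProj_smul {r : ℝ} (hr : 0 < r) (x : S n) :
    radialProj (r • (x : E (n + 1))) = x := by
  have h : r • (x : E (n + 1)) ≠ 0 := smul_ne_zero hr.ne' (coe_sphere_ne_zero x)
  apply Subtype.ext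
  rw [coe_radialProj h, norm_smul, norm_coe_sphere, Real.norm_of_nonneg hr.le, mul_one, smul_smul,
    inv_mul_cancel₀ hr.ne', one_smul]

/-- Restriction of the codomain to the sphere is available for globally smooth maps, so the
punctured space is treated as an open submanifold and the result is transferred back at the end. -/
theorem contMDiffAt_radialProj {p : E (n + 1)} (hp : p ≠ 0) :
    ContMDiffAt 𝓘(ℝ, E (n + 1)) (𝓡 n) ∞ (radialProj : E (n + 1) → S n) p := by
  let U : TopologicalSpace.Opens (E (n + 1)) := ⟨{0}ᶜ, isOpen_compl_singleton⟩
  have h : ContMDiff 𝓘(ℝ, E (n + 1)) 𝓘(ℝ, E (n + 1)) ∞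
      (fun q : U => ‖(q : E (n + 1))‖⁻¹ • (q : E (n + 1))) := by
    intro q
    have hq : (q : E (n + 1)) ≠ 0 := q.2
    have h1 : ContDiffAt ℝ ∞ (fun q : E (n + 1) => ‖q‖⁻¹ • q) (q : E (n + 1)) :=
      ((contDiffAt_norm ℝ hq).inv (norm_ne_zero_iff.2 hq)).smul contDiffAt_id
    exact h1.contMDiffAt.comp q (contMDiff_subtype_val q)
  have := Fact.mk (@finrank_euclideanSpace_fin ℝ _ (n + 1))
  have hmem : ∀ q : U, ‖(q : E (n + 1))‖⁻¹ • (q : E (n + 1)) ∈ Metric.sphere (0 : E (n + 1)) 1 := by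
    intro q
    have hq : (q : E (n + 1)) ≠ 0 := q.2
    simp [norm_smul, hq]
  have h2 := h.codRestrict_sphere (n := n) hmem
  have h3 : (fun q : U => radialProj (q : E (n + 1))) = Set.codRestrict
      (fun q : U => ‖(q : E (n + 1))‖⁻¹ • (q : E (n + 1))) _ hmem := by
    funext q
    apply Subtype.ext
    exact coe_radialProj q.2
  have h4 := h2 ⟨p, hp⟩
  rw [← h3] at h4
  exact contMDiffAt_subtype_iff.1 h4

theorem continuousAt_radialProj {p : E (n + 1)} (hp : p ≠ 0) :
    ContinuousAt (radialProj : E (n + 1) → S n) p :=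
  (contMDiffAt_radialProj hp).continuousAt

theorem contDiffOn_param {e : OpenPartialHomeomorph (S n) (E n)} (he : e ∈ charts n) :
    ContDiffOn ℝ ∞ (param e) e.target := by
  rw [← contMDiffOn_iff_contDiffOn]
  have := Fact.mk (@finrank_euclideanSpace_fin ℝ _ (n + 1))
  exact contMDiff_coe_sphere.comp_contMDiffOn (contMDiffOn_symm_of_mem_maximalAtlas he)

theorem contDiffOn_comp_chart_symm {e : OpenPartialHomeomorph (S n) (E n)} (he : e ∈ charts n)
    {r : S n → ℝ} (hr : ContMDiff (𝓡 n) 𝓘(ℝ, ℝ) 2 r) :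
    ContDiffOn ℝ 2 (fun v => r (e.symm v)) e.target := by
  rw [← contMDiffOn_iff_contDiffOn]
  exact hr.comp_contMDiffOn ((contMDiffOn_symm_of_mem_maximalAtlas he).of_le (by norm_cast))

/-- The map `e ∘ radialProj` extends the chart to an open set of the ambient space, as a left
inverse of `param e`. It serves both for the immersion property and for following a line across the
hypersurface. -/
theorem differentiableAt_chart_radialProj {e : OpenPartialHomeomorph (S n) (E n)}
    (he : e ∈ charts n) {p : E (n + 1)} (hp : p ≠ 0) (h : radialProj p ∈ e.source) :
    DifferentiableAt ℝ (fun q => e (radialProj q)) p := by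
  have h1 : ContMDiffAt 𝓘(ℝ, E (n + 1)) 𝓘(ℝ, E n) ∞ (fun q => e (radialProj q)) p :=
    (contMDiffAt_of_mem_maximalAtlas he h).comp p (contMDiffAt_radialProj hp)
  exact (contMDiffAt_iff_contDiffAt.1 h1).differentiableAt (by simp)

theorem fderiv_apply_eq_sum_pd {V : Type*} [NormedAddCommGroup V] [NormedSpace ℝ V]
    (f : E n → V) (u w : E n) : fderiv ℝ f u w = ∑ i, w i • pd i f u := by
  have h : w = ∑ i, w i • EuclideanSpace.single i (1 : ℝ) := by
    have := (EuclideanSpace.basisFun (Fin n) ℝ).sum_repr w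
    simpa using this.symm
  conv_lhs => rw [h]
  simp [map_sum, pd]

/-- Smooth local parametrizations of the sphere are immersions. -/
theorem linearIndependent_pd_param {e : OpenPartialHomeomorph (S n) (E n)} (he : e ∈ charts n)
    {u : E n} (hu : u ∈ e.target) : LinearIndependent ℝ (fun i => pd i (param e) u) := by
  rw [Fintype.linearIndependent_iff]
  intro c hc i
  have hd : DifferentiableAt ℝ (param e) u :=
    ((contDiffOn_param he).contDiffAt (e.open_target.mem_nhds hu)).differentiableAt (by simp)
  have h1 : ∀ v, radialProj (param e v) = e.symm v := fun v => by
    rw [← one_smul ℝ (param e v)]; exact radialProj_smul one_pos (e.symm v)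
  have hψ : DifferentiableAt ℝ (fun q => e (radialProj q)) (param e u) :=
    differentiableAt_chart_radialProj he (coe_sphere_ne_zero _) (by
      rw [h1]; exact e.map_target hu)
  -- A differentiable left inverse makes the derivative of `param e` injective, by the chain rule.
  have h2 : (fun v => e (radialProj (param e v))) =ᶠ[𝓝 u] id := by
    filter_upwards [e.open_target.mem_nhds hu] with v hv
    rw [h1, e.right_inv hv, id]
  have h3 : HasFDerivAt (fun v => e (radialProj (param e v))) _ u :=
    hψ.hasFDerivAt.comp u hd.hasFDerivAt
  have h4 := h3.unique (h2.hasFDerivAt_iff.2 (hasFDerivAt_id u))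
  have h5 : fderiv ℝ (param e) u (WithLp.toLp 2 c) = 0 := by
    rw [fderiv_apply_eq_sum_pd]; exact hc
  have h6 := congrArg (fun L => L (WithLp.toLp 2 c)) h4
  simp only [ContinuousLinearMap.comp_apply, h5, map_zero] at h6
  exact (congrArg (fun w : E n => w i) h6).symm

end Sphere

/-! ### The two sides of a star-shaped hypersurface -/

section StarShaped

variable {n : ℕ} {r : S n → ℝ}

/-- The region enclosed by the star-shaped hypersurface with radial function `r`. -/
def starInterior (r : S n → ℝ) : Set (E (n + 1)) := {p | ‖p‖ < r (radialProj p)}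

/-- The region outside the star-shaped hypersurface with radial function `r`. -/
def starExterior (r : S n → ℝ) : Set (E (n + 1)) := {p | r (radialProj p) < ‖p‖}

theorem compl_range_eq_union (hpos : ∀ p, 0 < r p) :
    (Set.range fun p : S n => r p • (p : E (n + 1)))ᶜ = starInterior r ∪ starExterior r := by
  ext p
  simp only [Set.mem_compl_iff, Set.mem_range, not_exists, starInterior, starExterior,
    Set.mem_union, Set.mem_ofPred_eq, ← ne_iff_lt_or_gt]
  constructor
  · intro h hp
    exact h (radialProj p) (by rw [← hp, norm_smul_radialProj])
  · rintro h q rfl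
    rw [radialProj_smul (hpos q), norm_smul, norm_coe_sphere, mul_one,
      Real.norm_of_nonneg (hpos q).le] at h
    exact h rfl

theorem ne_zero_of_mem_starExterior (hpos : ∀ p, 0 < r p) {p : E (n + 1)}
    (hp : p ∈ starExterior r) : p ≠ 0 :=
  norm_pos_iff.1 ((hpos _).trans hp)

theorem isOpen_starExterior (hr : Continuous r) (hpos : ∀ p, 0 < r p) :
    IsOpen (starExterior r) := by
  rw [isOpen_iff_mem_nhds]
  intro p hp
  have h := hr.continuousAt.comp
    (continuousAt_radialProj (ne_zero_of_mem_starExterior hpos hp))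
  exact h.eventually_lt continuous_norm.continuousAt hp

theorem isOpen_starInterior (hr : Continuous r) (hpos : ∀ p, 0 < r p) :
    IsOpen (starInterior r) := by
  rw [isOpen_iff_mem_nhds]
  intro p hp
  by_cases h0 : p = 0
  -- Continuity of `radialProj` is not available at the origin; the positive minimum of `r` on the
  -- compact sphere gives a ball inside instead.
  · obtain ⟨q, -, hq⟩ := isCompact_univ.exists_isMinOn
      ⟨radialProj (0 : E (n + 1)), Set.mem_univ _⟩ hr.continuousOn
    subst h0
    filter_upwards [Metric.ball_mem_nhds (0 : E (n + 1)) (hpos q)] with v hv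
    rw [mem_ball_zero_iff] at hv
    exact hv.trans_le (hq (Set.mem_univ _))
  · exact continuous_norm.continuousAt.eventually_lt
      (hr.continuousAt.comp (continuousAt_radialProj h0)) hp

theorem disjoint_starInterior_starExterior : Disjoint (starInterior r) (starExterior r) :=
  Set.disjoint_left.2 fun p (h1 : ‖p‖ < _) (h2 : _ < ‖p‖) => lt_asymm h1 h2

theorem isBounded_starInterior (hr : Continuous r) : Bornology.IsBounded (starInterior r) := by
  obtain ⟨q, -, hq⟩ := isCompact_univ.exists_isMaxOn
    ⟨radialProj (0 : E (n + 1)), Set.mem_univ _⟩ hr.continuousOn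
  refine isBounded_iff_forall_norm_le.2 ⟨r q, fun p hp => ?_⟩
  exact (le_of_lt hp).trans (hq (Set.mem_univ _))

/-- The two sides are disjoint open sets covering the complement, so a component meeting the bounded
side stays in it. -/
theorem isBounded_connectedComponentIn_of_mem_starInterior (hr : Continuous r)
    (hpos : ∀ p, 0 < r p) {p : E (n + 1)} (hp : p ∈ starInterior r) :
    Bornology.IsBounded
      (connectedComponentIn (Set.range fun p : S n => r p • (p : E (n + 1)))ᶜ p) := by
  refine (isBounded_starInterior hr).subset ?_
  have hp' : p ∈ (Set.range fun p : S n => r p • (p : E (n + 1)))ᶜ := by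
    rw [compl_range_eq_union hpos]; exact Or.inl hp
  refine isPreconnected_connectedComponentIn.subset_left_of_subset_union
    (isOpen_starInterior hr hpos) (isOpen_starExterior hr hpos)
    disjoint_starInterior_starExterior ?_ ⟨p, mem_connectedComponentIn hp', hp⟩
  rw [← compl_range_eq_union hpos]
  exact connectedComponentIn_subset _ _

/-- The ray `t p`, `t ≥ 1`, is connected, unbounded, and never meets the hypersurface again. -/
theorem not_isBounded_connectedComponentIn_of_mem_starExterior
    (hpos : ∀ p, 0 < r p) {p : E (n + 1)} (hp : p ∈ starExterior r) :
    ¬ Bornology.IsBounded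
      (connectedComponentIn (Set.range fun p : S n => r p • (p : E (n + 1)))ᶜ p) := by
  have hp0 := ne_zero_of_mem_starExterior hpos hp
  have hpn : 0 < ‖p‖ := norm_pos_iff.2 hp0
  have hconn : IsPreconnected ((fun t : ℝ => t • p) '' Set.Ici 1) :=
    isPreconnected_Ici.image _ (by fun_prop)
  have hsub : (fun t : ℝ => t • p) '' Set.Ici 1 ⊆
      (Set.range fun p : S n => r p • (p : E (n + 1)))ᶜ := by
    rw [compl_range_eq_union hpos]
    rintro _ ⟨t, ht, rfl⟩
    refine Or.inr ?_
    have ht' : (1 : ℝ) ≤ t := ht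
    have h1 : radialProj (t • p) = radialProj p := by
      conv_lhs => rw [← norm_smul_radialProj p, smul_smul]
      exact radialProj_smul (by positivity) _
    change r (radialProj (t • p)) < ‖t • p‖
    rw [h1, norm_smul, Real.norm_of_nonneg (by linarith)]
    have hp' : r (radialProj p) < ‖p‖ := hp
    nlinarith
  have h1 := hconn.subset_connectedComponentIn (x := p) ⟨1, Set.self_mem_Ici, one_smul _ _⟩ hsub
  intro hb
  obtain ⟨C, hC⟩ := isBounded_iff_forall_norm_le.1 (hb.subset h1)
  -- This multiple of `p` has norm `‖p‖ + |C|`, which exceeds the supposed bound `C`.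
  have h2 := hC _ ⟨1 + |C| / ‖p‖, by simp; positivity, rfl⟩
  rw [norm_smul, Real.norm_of_nonneg (by positivity), add_mul, div_mul_cancel₀ _ hpn.ne'] at h2
  linarith [le_abs_self C]

/-- A line transversal to a star-shaped hypersurface passes from its interior to its exterior in the
direction of a normal that has a positive radial component. -/
theorem eventually_mem_starExterior_and_starInterior
    {e : OpenPartialHomeomorph (S n) (E n)} (he : e ∈ charts n)
    (hr : ContMDiff (𝓡 n) 𝓘(ℝ, ℝ) 2 r) (hpos : ∀ p, 0 < r p) {u : E n} (hu : u ∈ e.target)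
    {ν : E (n + 1)} (hν : ‖ν‖ = 1)
    (htan : ∀ i, ⟪pd i (fun v => r (e.symm v) • param e v) u, ν⟫ = 0)
    (hrad : 0 < ⟪param e u, ν⟫) :
    (∀ᶠ s : ℝ in 𝓝[>] 0, r (e.symm u) • param e u + s • ν ∈ starExterior r) ∧
    (∀ᶠ s : ℝ in 𝓝[>] 0, r (e.symm u) • param e u + s • (-ν) ∈ starInterior r) := by
  set F : E n → E (n + 1) := fun v => r (e.symm v) • param e v with hF
  set γ : ℝ → E (n + 1) := fun s => F u + s • ν with hγ
  have hγ0 : γ 0 = F u := by simp [hγ]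
  have hπ0 : radialProj (F u) = e.symm u := radialProj_smul (hpos _) _
  have hne : F u ≠ 0 := smul_ne_zero (hpos _).ne' (coe_sphere_ne_zero _)
  have hγd : HasDerivAt γ ν 0 := by
    have h1 := ((hasDerivAt_id (0 : ℝ)).smul_const ν).const_add (F u)
    rw [one_smul] at h1
    exact h1
  have hT := e.open_target.mem_nhds hu
  have hxd : DifferentiableAt ℝ (param e) u :=
    ((contDiffOn_param he).contDiffAt hT).differentiableAt (by simp)
  have hFd : DifferentiableAt ℝ F u :=
    (((contDiffOn_comp_chart_symm he hr).contDiffAt hT).differentiableAt (by simp)).smul hxd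
  -- For small `s`, `F (v s)` is the point of the hypersurface on the same ray as `γ s`.
  set v : ℝ → E n := fun s => e (radialProj (γ s)) with hv
  have hv0 : v 0 = u := by simp only [hv, hγ0, hπ0, e.right_inv hu]
  have hsrc : radialProj (γ 0) ∈ e.source := by rw [hγ0, hπ0]; exact e.map_target hu
  have hvd : DifferentiableAt ℝ v 0 :=
    (differentiableAt_chart_radialProj he (by rw [hγ0]; exact hne) hsrc).comp (0 : ℝ)
      hγd.differentiableAt
  have hFvd : HasDerivAt (fun s => F (v s)) (fderiv ℝ F u (deriv v 0)) 0 := by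
    have h1 : HasFDerivAt F (fderiv ℝ F u) (v 0) := by rw [hv0]; exact hFd.hasFDerivAt
    exact h1.comp_hasDerivAt 0 hvd.hasDerivAt
  -- The velocity of `F (v s)` at `0` is tangent to the hypersurface, hence invisible to `ν`; only
  -- `⟪ν, ν⟫ = 1` remains.
  have hdiff : HasDerivAt (fun s => ⟪γ s - F (v s), ν⟫) 1 0 := by
    have h1 := (hγd.sub hFvd).inner ℝ (hasDerivAt_const (0 : ℝ) ν)
    convert! h1 using 1
    rw [inner_zero_right, zero_add, inner_sub_left, real_inner_self_eq_norm_sq, hν,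
      fderiv_apply_eq_sum_pd, sum_inner]
    simp [inner_smul_left, htan]
  have hzero : ⟪γ 0 - F (v 0), ν⟫ = 0 := by rw [hγ0, hv0, sub_self, inner_zero_left]
  have hxv : ContinuousAt (fun s => ⟪param e (v s), ν⟫) 0 := by
    have h1 : ContinuousAt (param e) (v 0) := by rw [hv0]; exact hxd.continuousAt
    exact (h1.comp hvd.continuousAt).inner continuousAt_const
  have hkpos : ∀ᶠ s in 𝓝 (0 : ℝ), 0 < ⟪param e (v s), ν⟫ :=
    continuousAt_const.eventually_lt hxv (by simpa [hv0] using hrad)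
  have hsrc' : ∀ᶠ s in 𝓝 (0 : ℝ), radialProj (γ s) ∈ e.source := by
    have h1 : ContinuousAt (radialProj : E (n + 1) → S n) (γ 0) :=
      continuousAt_radialProj (by rw [hγ0]; exact hne)
    exact (h1.comp hγd.continuousAt).eventually (e.open_source.mem_nhds hsrc)
  -- The difference is radial, so its inner product with `ν` has the sign of `‖γ s‖ - r`, which
  -- decides the side.
  have hkey : ∀ᶠ s in 𝓝 (0 : ℝ), 0 < ⟪param e (v s), ν⟫ ∧ ⟪γ s - F (v s), ν⟫ =
      (‖γ s‖ - r (radialProj (γ s))) * ⟪param e (v s), ν⟫ := by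
    filter_upwards [hkpos, hsrc'] with s hs1 hs2
    refine ⟨hs1, ?_⟩
    have h1 : e.symm (v s) = radialProj (γ s) := e.left_inv hs2
    have h2 : γ s - F (v s) = (‖γ s‖ - r (radialProj (γ s))) • param e (v s) := by
      rw [sub_smul]
      simp only [hF, param, h1, norm_smul_radialProj]
    rw [h2, inner_smul_left]
    rfl
  have hslope := hasDerivAt_iff_tendsto_slope.1 hdiff
  have hslope1 : ∀ᶠ s in 𝓝[≠] (0 : ℝ), 0 < s⁻¹ * ⟪γ s - F (v s), ν⟫ := by
    filter_upwards [hslope.eventually (lt_mem_nhds one_pos)] with s hs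
    simpa [slope_def_field, hzero, div_eq_inv_mul] using hs
  have hall : ∀ᶠ s in 𝓝[≠] (0 : ℝ), 0 < s⁻¹ * (‖γ s‖ - r (radialProj (γ s))) := by
    filter_upwards [hslope1, hkey.filter_mono nhdsWithin_le_nhds] with s h1 h2
    rw [h2.2, ← mul_assoc] at h1
    exact pos_of_mul_pos_left h1 h2.1.le
  have hright : 𝓝[>] (0 : ℝ) ≤ 𝓝[≠] 0 := nhdsWithin_mono _ fun s (hs : 0 < s) => hs.ne'
  constructor
  · filter_upwards [hall.filter_mono hright, self_mem_nhdsWithin] with s hs hs0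
    have hs0' : (0 : ℝ) < s := hs0
    exact sub_pos.1 (pos_of_mul_pos_right hs (inv_pos.2 hs0').le)
  · have hneg : Filter.Tendsto (fun s : ℝ => -s) (𝓝[>] 0) (𝓝[≠] 0) := by
      have h1 : Filter.Tendsto (fun s : ℝ => -s) (𝓝[>] 0) (𝓝[<] (-0)) := tendsto_neg_nhdsGT
      rw [neg_zero] at h1
      exact h1.mono_right (nhdsWithin_mono _ fun s (hs : s < 0) => hs.ne)
    filter_upwards [hneg.eventually hall, self_mem_nhdsWithin] with s hs hs0
    have hs0' : (0 : ℝ) < s := hs0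
    have h1 : γ (-s) = r (e.symm u) • param e u + s • (-ν) := by simp [hγ, hF]
    rw [h1] at hs
    have h2 : (-s)⁻¹ < 0 := inv_lt_zero.2 (neg_lt_zero.2 hs0')
    exact sub_neg.1 (neg_of_mul_pos_right hs h2.le)

end StarShaped

/-! ### Partial derivatives -/

section PartialDerivatives

variable {n : ℕ} {V : Type*} [NormedAddCommGroup V]

section NormedSpace

variable [NormedSpace ℝ V] {F : E n → V} {f : E n → ℝ} {u : E n}

theorem differentiableAt_of_contDiffAt_two (hF : ContDiffAt ℝ 2 F u) : DifferentiableAt ℝ F u :=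
  hF.differentiableAt (by norm_num)

theorem differentiableAt_fderiv_of_contDiffAt_two (hF : ContDiffAt ℝ 2 F u) :
    DifferentiableAt ℝ (fderiv ℝ F) u :=
  (hF.fderiv_right (m := 1) (by norm_num)).differentiableAt (by norm_num)

theorem differentiableAt_pd (hF : ContDiffAt ℝ 2 F u) (i : Fin n) :
    DifferentiableAt ℝ (pd i F) u :=
  (differentiableAt_fderiv_of_contDiffAt_two hF).clm_apply (differentiableAt_const _)

theorem eventually_contDiffAt_two (hF : ContDiffAt ℝ 2 F u) :
    ∀ᶠ v in 𝓝 u, ContDiffAt ℝ 2 F v :=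
  hF.eventually (by norm_num)

theorem pd_pd_comm (hF : ContDiffAt ℝ 2 F u) (i j : Fin n) :
    pd i (pd j F) u = pd j (pd i F) u := by
  have h : ∀ i j : Fin n, pd i (pd j F) u =
      fderiv ℝ (fderiv ℝ F) u (EuclideanSpace.single i 1) (EuclideanSpace.single j 1) := by
    intro i j
    have h1 := (differentiableAt_fderiv_of_contDiffAt_two hF).hasFDerivAt.clm_apply
      (hasFDerivAt_const (EuclideanSpace.single j (1 : ℝ)) u)
    change fderiv ℝ (fun v => fderiv ℝ F v (EuclideanSpace.single j 1)) u _ = _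
    rw [h1.fderiv]
    simp
  rw [h, h]
  exact (hF.isSymmSndFDerivAt (by simp)) _ _

theorem pd_congr {F' : E n → V} (h : F =ᶠ[𝓝 u] F') (i : Fin n) : pd i F u = pd i F' u := by
  rw [pd, h.fderiv_eq, pd]

theorem pd_const (c : V) (i : Fin n) : pd i (fun _ : E n => c) u = 0 := by simp [pd]

theorem pd_add {F' : E n → V} (hF : DifferentiableAt ℝ F u) (hF' : DifferentiableAt ℝ F' u)
    (i : Fin n) : pd i (fun v => F v + F' v) u = pd i F u + pd i F' u := by
  simp only [pd]
  rw [fderiv_fun_add hF hF']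
  rfl

theorem pd_smul (hf : DifferentiableAt ℝ f u) (hF : DifferentiableAt ℝ F u) (i : Fin n) :
    pd i (fun v => f v • F v) u = f u • pd i F u + pd i f u • F u := by
  simp only [pd]
  rw [fderiv_fun_smul hf hF]
  simp

theorem pd_pd_smul (hf : ContDiffAt ℝ 2 f u) (hF : ContDiffAt ℝ 2 F u) (i j : Fin n) :
    pd i (pd j fun v => f v • F v) u =
      f u • pd i (pd j F) u + pd i f u • pd j F u + pd j f u • pd i F u
        + pd i (pd j f) u • F u := by
  have h : (pd j fun v => f v • F v) =ᶠ[𝓝 u] fun v => f v • pd j F v + pd j f v • F v := by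
    filter_upwards [eventually_contDiffAt_two hf, eventually_contDiffAt_two hF] with v h1 h2
    exact pd_smul (differentiableAt_of_contDiffAt_two h1) (differentiableAt_of_contDiffAt_two h2) j
  have hf1 := differentiableAt_of_contDiffAt_two hf
  have hF1 := differentiableAt_of_contDiffAt_two hF
  rw [pd_congr h, pd_add (hf1.fun_smul (differentiableAt_pd hF j)) ((differentiableAt_pd hf j).fun_smul hF1),
    pd_smul hf1 (differentiableAt_pd hF j), pd_smul (differentiableAt_pd hf j) hF1]
  abel

end NormedSpace

theorem pd_inner [InnerProductSpace ℝ V] {F F' : E n → V} {u : E n}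
    (hF : DifferentiableAt ℝ F u) (hF' : DifferentiableAt ℝ F' u) (i : Fin n) :
    pd i (fun v => ⟪F v, F' v⟫) u = ⟪F u, pd i F' u⟫ + ⟪pd i F u, F' u⟫ := by
  simp only [pd]
  exact fderiv_inner_apply ℝ hF hF' _

end PartialDerivatives

/-! ### Local parametrizations of the sphere -/

section Immersion

variable {n : ℕ} {x : E n → E (n + 1)} {f : E n → ℝ} {u : E n}

theorem metric_comm (x : E n → E (n + 1)) (u : E n) (i j : Fin n) :
    metric x u i j = metric x u j i :=
  real_inner_comm (pd j x u) (pd i x u)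

theorem isUnit_det_metric (hli : LinearIndependent ℝ fun i => pd i x u) :
    IsUnit (metric x u).det :=
  (Matrix.posDef_gram_of_linearIndependent hli).det_pos.ne'.isUnit

theorem invMetric_comm (x : E n → E (n + 1)) (u : E n) (i j : Fin n) :
    invMetric x u i j = invMetric x u j i := by
  have h : (metric x u).transpose = metric x u := Matrix.ext fun i j => metric_comm x u j i
  have h1 : (invMetric x u).transpose = invMetric x u := by
    rw [invMetric, Matrix.transpose_nonsing_inv, h]
  exact congrFun (congrFun h1 j) i

theorem sum_metric_mul_grad (hli : LinearIndependent ℝ fun i => pd i x u) (i : Fin n) :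
    ∑ j, metric x u i j * grad x f u j = pd i f u := by
  have h : (metric x u).mulVec ((invMetric x u).mulVec fun m => pd m f u) = fun m => pd m f u := by
    rw [Matrix.mulVec_mulVec, invMetric, Matrix.mul_nonsing_inv _ (isUnit_det_metric hli),
      Matrix.one_mulVec]
  exact congrFun h i

theorem gradNormSq_eq_sum (hli : LinearIndependent ℝ fun i => pd i x u) :
    gradNormSq x f u = ∑ i, pd i f u * grad x f u i := by
  refine Finset.sum_congr rfl fun i _ => ?_
  rw [← sum_metric_mul_grad hli i, Finset.sum_mul]
  exact Finset.sum_congr rfl fun j _ => by ring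

/-- The embedded gradient `∇^k f ∂_k x`. -/
def gradVec (x : E n → E (n + 1)) (f : E n → ℝ) (u : E n) : E (n + 1) :=
  ∑ k, grad x f u k • pd k x u

theorem inner_gradVec (x : E n → E (n + 1)) (f : E n → ℝ) (u : E n) (w : E (n + 1)) :
    ⟪w, gradVec x f u⟫ = ∑ k, grad x f u k * ⟪w, pd k x u⟫ := by
  simp [gradVec, inner_sum, inner_smul_right]

theorem inner_pd_gradVec (hli : LinearIndependent ℝ fun i => pd i x u) (i : Fin n) :
    ⟪pd i x u, gradVec x f u⟫ = pd i f u := by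
  rw [inner_gradVec, ← sum_metric_mul_grad hli i]
  exact Finset.sum_congr rfl fun k _ => mul_comm _ _

theorem inner_gradVec_self (hli : LinearIndependent ℝ fun i => pd i x u) :
    ⟪gradVec x f u, gradVec x f u⟫ = gradNormSq x f u := by
  rw [inner_gradVec, gradNormSq_eq_sum hli]
  refine Finset.sum_congr rfl fun k _ => ?_
  rw [real_inner_comm, inner_pd_gradVec hli, mul_comm]

theorem gradNormSq_nonneg (hli : LinearIndependent ℝ fun i => pd i x u) :
    0 ≤ gradNormSq x f u := by
  rw [← inner_gradVec_self hli]; exact real_inner_self_nonneg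

theorem inner_pd_self_of_norm_eq_one (hx : DifferentiableAt ℝ x u) (h1 : ∀ v, ‖x v‖ = 1)
    (i : Fin n) : ⟪pd i x u, x u⟫ = 0 := by
  have h := pd_inner hx hx i
  have h2 : (fun v => ⟪x v, x v⟫) = fun _ => (1 : ℝ) := by
    funext v; rw [real_inner_self_eq_norm_sq, h1, one_pow]
  rw [h2, pd_const, real_inner_comm] at h
  linarith

/-- Differentiate `⟪∂_j x, x⟫ = 0`, which holds near `u` and not only at `u`. -/
theorem inner_pd_pd_self_of_norm_eq_one (hx : ContDiffAt ℝ 2 x u) (h1 : ∀ v, ‖x v‖ = 1)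
    (i j : Fin n) : ⟪pd i (pd j x) u, x u⟫ = -metric x u i j := by
  have h := pd_inner (differentiableAt_pd hx j) (differentiableAt_of_contDiffAt_two hx) i
  have h2 : (fun v => ⟪pd j x v, x v⟫) =ᶠ[𝓝 u] fun _ => (0 : ℝ) := by
    filter_upwards [eventually_contDiffAt_two hx] with v hv
    exact inner_pd_self_of_norm_eq_one (differentiableAt_of_contDiffAt_two hv) h1 j
  rw [pd_congr h2, pd_const, real_inner_comm] at h
  have h3 : metric x u i j = ⟪pd i x u, pd j x u⟫ := rfl
  linarith

theorem pd_metric (hx : ContDiffAt ℝ 2 x u) (i j k : Fin n) :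
    pd i (fun v => metric x v j k) u =
      ⟪pd i (pd k x) u, pd j x u⟫ + ⟪pd i (pd j x) u, pd k x u⟫ := by
  have h := pd_inner (differentiableAt_pd hx j) (differentiableAt_pd hx k) i
  rw [real_inner_comm (pd i (pd k x) u)] at h
  exact h

/-- The Christoffel symbols are the tangential components of `∂_i ∂_j x`: once the metric
derivatives are expanded and mixed partials commuted, all but `2 ⟪∂_i ∂_j x, ∂_m x⟫` cancels. -/
theorem sum_christoffel_mul_pd (hx : ContDiffAt ℝ 2 x u) (i j : Fin n) :
    ∑ k, christoffel x u i j k * pd k f u = ⟪pd i (pd j x) u, gradVec x f u⟫ := by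
  have h : ∀ k, christoffel x u i j k =
      ∑ m, invMetric x u k m * ⟪pd i (pd j x) u, pd m x u⟫ := by
    intro k
    rw [christoffel, Finset.mul_sum]
    refine Finset.sum_congr rfl fun m _ => ?_
    rw [pd_metric hx, pd_metric hx, pd_metric hx, pd_pd_comm hx j i, pd_pd_comm hx m i,
      pd_pd_comm hx m j]
    ring
  simp only [h, inner_gradVec, grad, Finset.sum_mul]
  rw [Finset.sum_comm]
  refine Finset.sum_congr rfl fun m _ => Finset.sum_congr rfl fun k _ => ?_
  rw [invMetric_comm x u k m]
  ring

end Immersion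

/-! ### Radial graphs over the sphere -/

section RadialGraph

variable {n : ℕ} {x : E n → E (n + 1)} {f : E n → ℝ} {u : E n}

/-- The unnormalized normal `f x - ∇f` of the radial graph `f x`. -/
def graphNormalVec (x : E n → E (n + 1)) (f : E n → ℝ) (u : E n) : E (n + 1) :=
  f u • x u - gradVec x f u

/-- The unit normal of the radial graph `f x` with positive radial component. -/
def graphNormal (x : E n → E (n + 1)) (f : E n → ℝ) (u : E n) : E (n + 1) :=
  (√(f u ^ 2 + gradNormSq x f u))⁻¹ • graphNormalVec x f u

variable (hx : ContDiffAt ℝ 2 x u) (hx1 : ∀ v, ‖x v‖ = 1)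
  (hli : LinearIndependent ℝ fun i => pd i x u) (hf : ContDiffAt ℝ 2 f u) (hpos : 0 < f u)

include hx hx1

theorem inner_self_gradVec : ⟪x u, gradVec x f u⟫ = 0 := by
  rw [inner_gradVec]
  refine Finset.sum_eq_zero fun k _ => ?_
  rw [real_inner_comm, inner_pd_self_of_norm_eq_one (differentiableAt_of_contDiffAt_two hx) hx1,
    mul_zero]

theorem inner_self_graphNormalVec : ⟪x u, graphNormalVec x f u⟫ = f u := by
  rw [graphNormalVec, inner_sub_right, inner_smul_right, real_inner_self_eq_norm_sq, hx1,
    inner_self_gradVec hx hx1]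
  ring

include hli in
theorem norm_graphNormalVec : ‖graphNormalVec x f u‖ = √(f u ^ 2 + gradNormSq x f u) := by
  rw [eq_comm, Real.sqrt_eq_iff_eq_sq (by have := gradNormSq_nonneg (f := f) hli; positivity)
    (norm_nonneg _), ← real_inner_self_eq_norm_sq]
  conv_rhs => rw [graphNormalVec, inner_sub_left, inner_smul_left, ← graphNormalVec]
  rw [inner_self_graphNormalVec hx hx1, graphNormalVec, inner_sub_right, inner_smul_right,
    real_inner_comm, inner_self_gradVec hx hx1, inner_gradVec_self hli]
  simp
  ring

include hli hpos in
theorem norm_graphNormal : ‖graphNormal x f u‖ = 1 := by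
  have h := gradNormSq_nonneg (f := f) hli
  have h1 : 0 < √(f u ^ 2 + gradNormSq x f u) := by positivity
  rw [graphNormal, norm_smul, norm_graphNormalVec hx hx1 hli, norm_inv,
    Real.norm_of_nonneg h1.le, inv_mul_cancel₀ h1.ne']

include hli hpos in
theorem inner_self_graphNormal_pos : 0 < ⟪x u, graphNormal x f u⟫ := by
  have h := gradNormSq_nonneg (f := f) hli
  rw [graphNormal, inner_smul_right, inner_self_graphNormalVec hx hx1]
  positivity

include hli hf in
theorem inner_pd_graph_graphNormal (i : Fin n) :
    ⟪pd i (fun v => f v • x v) u, graphNormal x f u⟫ = 0 := by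
  have hx' := differentiableAt_of_contDiffAt_two hx
  rw [pd_smul (differentiableAt_of_contDiffAt_two hf) hx', graphNormal, inner_smul_right,
    inner_add_left, inner_smul_left, inner_smul_left, inner_self_graphNormalVec hx hx1,
    graphNormalVec, inner_sub_right, inner_smul_right, inner_pd_self_of_norm_eq_one hx' hx1,
    inner_pd_gradVec hli]
  simp
  right
  ring

include hli hf hpos in
-- Pairing a relation `∑ c_i (f ∂_i x + ∂_i f x) = 0` with `x` kills the radial part, which leaves a
-- relation among the `∂_i x`.
theorem linearIndependent_pd_graph :
    LinearIndependent ℝ fun i => pd i (fun v => f v • x v) u := by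
  have hx' := differentiableAt_of_contDiffAt_two hx
  rw [Fintype.linearIndependent_iff] at hli ⊢
  intro c hc
  simp only [pd_smul (differentiableAt_of_contDiffAt_two hf) hx', smul_add,
    Finset.sum_add_distrib] at hc
  have h1 := congrArg (fun w => ⟪w, x u⟫) hc
  simp only [inner_add_left, sum_inner, inner_smul_left, inner_zero_left,
    inner_pd_self_of_norm_eq_one hx' hx1, real_inner_self_eq_norm_sq, hx1] at h1
  simp at h1
  have h2 : ∑ i, c i • pd i f u • x u = 0 := by
    simp only [smul_smul, ← Finset.sum_smul, h1, zero_smul]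
  rw [h2, add_zero] at hc
  apply hli
  have h3 : f u • ∑ i, c i • pd i x u = 0 := by
    rw [← hc, Finset.smul_sum]
    exact Finset.sum_congr rfl fun i _ => smul_comm _ _ _
  exact (smul_eq_zero.1 h3).resolve_left hpos.ne'

include hf in
theorem metric_graph (i j : Fin n) :
    metric (fun v => f v • x v) u i j = f u ^ 2 * metric x u i j + pd i f u * pd j f u := by
  have hx' := differentiableAt_of_contDiffAt_two hx
  have hf' := differentiableAt_of_contDiffAt_two hf
  change ⟪pd i (fun v => f v • x v) u, pd j (fun v => f v • x v) u⟫ = _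
  have h3 : ⟪pd i x u, pd j x u⟫ = metric x u i j := rfl
  have h4 : ⟪x u, pd j x u⟫ = 0 := by
    rw [real_inner_comm, inner_pd_self_of_norm_eq_one hx' hx1]
  rw [pd_smul hf' hx', pd_smul hf' hx']
  simp only [inner_add_left, inner_add_right, inner_smul_left, inner_smul_right, h3, h4,
    inner_pd_self_of_norm_eq_one hx' hx1, real_inner_self_eq_norm_sq, hx1]
  simp
  ring

include hli hf hpos in
-- This is the Sherman–Morrison formula for `f² g + df ⊗ df`, checked by multiplying out.
theorem invMetric_graph (i j : Fin n) :
    invMetric (fun v => f v • x v) u i j = (f u ^ 2)⁻¹ * (invMetric x u i j -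
      (f u ^ 2 + gradNormSq x f u)⁻¹ * (grad x f u i * grad x f u j)) := by
  have hN := gradNormSq_nonneg (f := f) hli
  set W := f u ^ 2 + gradNormSq x f u with hW
  have hWpos : 0 < W := by positivity
  have h : invMetric (fun v => f v • x v) u = Matrix.of fun i j =>
      (f u ^ 2)⁻¹ * (invMetric x u i j - W⁻¹ * (grad x f u i * grad x f u j)) := by
    refine Matrix.inv_eq_right_inv (Matrix.ext fun a b => ?_)
    have h1 : ∑ k, metric x u a k * invMetric x u k b = (1 : Matrix (Fin n) (Fin n) ℝ) a b :=
      congrFun (congrFun (Matrix.mul_nonsing_inv _ (isUnit_det_metric hli)) a) b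
    have h2 : ∑ k, pd k f u * invMetric x u k b = grad x f u b :=
      Finset.sum_congr rfl fun k _ => by rw [invMetric_comm x u k b, mul_comm]
    have h3 := sum_metric_mul_grad (f := f) hli a
    have h4 := gradNormSq_eq_sum (f := f) hli
    rw [Matrix.mul_apply]
    have h5 : ∀ k, metric (fun v => f v • x v) u a k * (Matrix.of fun i j =>
        (f u ^ 2)⁻¹ * (invMetric x u i j - W⁻¹ * (grad x f u i * grad x f u j))) k b =
        metric x u a k * invMetric x u k b
          + ((f u ^ 2)⁻¹ * pd a f u) * (pd k f u * invMetric x u k b)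
          - (W⁻¹ * grad x f u b) * (metric x u a k * grad x f u k)
          - ((f u ^ 2)⁻¹ * W⁻¹ * pd a f u * grad x f u b) * (pd k f u * grad x f u k) := by
      intro k
      rw [metric_graph hx hx1 hf, Matrix.of_apply]
      field_simp
      ring
    simp only [h5, Finset.sum_add_distrib, Finset.sum_sub_distrib, ← Finset.mul_sum, h1, h2, h3,
      ← h4]
    have h6 : gradNormSq x f u = W - f u ^ 2 := by rw [hW]; ring
    rw [h6]
    field_simp
    ring
  exact congrFun (congrFun h i) j

include hli hf in
-- The pairing of `f ∂_i ∂_j x` with `-∇f` supplies the Christoffel term of the Hessian, its pairing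
-- with `f x` gives `-f² g_{ij}`, and each of the two mixed terms gives `-∂_i f ∂_j f`.
theorem inner_pd_pd_graph_graphNormalVec (i j : Fin n) :
    ⟪pd i (pd j fun v => f v • x v) u, graphNormalVec x f u⟫ =
      f u * hess x f u i j - f u ^ 2 * metric x u i j - 2 * (pd i f u * pd j f u) := by
  have hx' := differentiableAt_of_contDiffAt_two hx
  rw [pd_pd_smul hf hx, hess, sum_christoffel_mul_pd hx]
  simp only [inner_add_left, inner_smul_left, graphNormalVec, inner_sub_right, inner_smul_right,
    inner_pd_self_of_norm_eq_one hx' hx1, inner_pd_pd_self_of_norm_eq_one hx hx1,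
    inner_self_gradVec hx hx1, inner_pd_gradVec hli, real_inner_self_eq_norm_sq, hx1]
  simp
  ring

include hli hf hpos in
/-- The mean curvature of the radial graph `f x` is `-(f / √(f² + |∇f|²)) G(f)`. -/
theorem meanCurvature_graph :
    meanCurvature (fun v => f v • x v) (graphNormal x f u) u =
      -(f u * G x f u / √(f u ^ 2 + gradNormSq x f u)) := by
  have hN := gradNormSq_nonneg (f := f) hli
  have hWpos : 0 < f u ^ 2 + gradNormSq x f u := by positivity
  have hs : 0 < √(f u ^ 2 + gradNormSq x f u) := by positivity
  have hterm : ∀ i j, invMetric (fun v => f v • x v) u i j *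
      (-⟪pd i (pd j fun v => f v • x v) u, graphNormal x f u⟫) =
      -(√(f u ^ 2 + gradNormSq x f u))⁻¹ * ((f u)⁻¹ * (invMetric x u i j * hess x f u i j)
        - (f u)⁻¹ * (f u ^ 2 + gradNormSq x f u)⁻¹ *
            (hess x f u i j * grad x f u i * grad x f u j)
        - (invMetric x u i j * metric x u j i)
        + (f u ^ 2 + gradNormSq x f u)⁻¹ * (metric x u i j * grad x f u i * grad x f u j)
        - 2 * (f u ^ 2)⁻¹ * (pd i f u * (invMetric x u i j * pd j f u))
        + 2 * (f u ^ 2)⁻¹ * (f u ^ 2 + gradNormSq x f u)⁻¹ *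
            ((pd i f u * grad x f u i) * (pd j f u * grad x f u j))) := by
    intro i j
    rw [invMetric_graph hx hx1 hli hf hpos, graphNormal, inner_smul_right,
      inner_pd_pd_graph_graphNormalVec hx hx1 hli hf, metric_comm x u j i]
    field_simp
    ring
  have h1 : ∑ i, ∑ j, invMetric x u i j * metric x u j i = n := by
    have h : ∀ i, ∑ j, invMetric x u i j * metric x u j i = 1 := fun i => by
      have := congrFun (congrFun (Matrix.nonsing_inv_mul _ (isUnit_det_metric hli)) i) i
      rwa [Matrix.one_apply_eq] at this
    simp [h]
  have h2 : ∑ i, ∑ j, pd i f u * (invMetric x u i j * pd j f u) = gradNormSq x f u := by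
    rw [gradNormSq_eq_sum hli]
    simp only [← Finset.mul_sum]
    rfl
  have h3 : ∑ i, ∑ j, (pd i f u * grad x f u i) * (pd j f u * grad x f u j) =
      gradNormSq x f u * gradNormSq x f u := by
    rw [gradNormSq_eq_sum hli, Finset.sum_mul_sum]
  rw [meanCurvature]
  simp only [hterm, Finset.sum_add_distrib, Finset.sum_sub_distrib, ← Finset.mul_sum, h1]
  simp only [← Finset.mul_sum] at h2 h3
  rw [h2, h3]
  -- With `N = |∇f|²` and `W = f² + N`, the pure gradient terms `N/W - 2N/f² + 2N²/(f² W)` collapse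
  -- to `-N/W`, because `W - N = f²`.
  change -(√(f u ^ 2 + gradNormSq x f u))⁻¹ * ((f u)⁻¹ * laplacian x f u
    - (f u)⁻¹ * (f u ^ 2 + gradNormSq x f u)⁻¹ * gradHessGrad x f u - n
    + (f u ^ 2 + gradNormSq x f u)⁻¹ * gradNormSq x f u - 2 * (f u ^ 2)⁻¹ * gradNormSq x f u
    + 2 * (f u ^ 2)⁻¹ * (f u ^ 2 + gradNormSq x f u)⁻¹ * (gradNormSq x f u * gradNormSq x f u)) = _
  rw [G]
  field_simp
  ring

end RadialGraph

/-! ### Hyperplanes -/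

section Hyperplane

variable {n : ℕ} {v : Fin n → E (n + 1)} {ν : E (n + 1)}

/-- The orthogonal complement of `n` independent vectors in dimension `n + 1` is a line, spanned by
`ν`. -/
theorem exists_eq_smul_of_inner_eq_zero (hv : LinearIndependent ℝ v) (hν : ‖ν‖ = 1)
    (hperp : ∀ i, ⟪v i, ν⟫ = 0) {w : E (n + 1)} (hw : ∀ i, ⟪v i, w⟫ = 0) :
    ∃ c : ℝ, w = c • ν := by
  have hmem : ∀ w : E (n + 1), (∀ i, ⟪v i, w⟫ = 0) → w ∈ (Submodule.span ℝ (Set.range v))ᗮ := by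
    intro w hw
    rw [Submodule.mem_orthogonal]
    intro y hy
    induction hy using Submodule.span_induction with
    | mem y hy => obtain ⟨i, rfl⟩ := hy; exact hw i
    | zero => exact inner_zero_left _
    | add y z _ _ h1 h2 => rw [inner_add_left, h1, h2, add_zero]
    | smul c y _ h => rw [inner_smul_left, h, mul_zero]
  have h1 := (Submodule.span ℝ (Set.range v)).finrank_add_finrank_orthogonal
  rw [finrank_span_eq_card hv, finrank_euclideanSpace, Fintype.card_fin, Fintype.card_fin] at h1
  have h2 : Module.finrank ℝ (Submodule.span ℝ (Set.range v))ᗮ = 1 := by omega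
  have h3 : (⟨ν, hmem ν hperp⟩ : (Submodule.span ℝ (Set.range v))ᗮ) ≠ 0 := by
    intro h
    have h4 : ν = 0 := congrArg Subtype.val h
    rw [h4, norm_zero] at hν
    exact zero_ne_one hν
  obtain ⟨c, hc⟩ := (finrank_eq_one_iff_of_nonzero' _ h3).1 h2 ⟨w, hmem w hw⟩
  exact ⟨c, (congrArg Subtype.val hc).symm⟩

theorem exists_sum_smul_eq_of_inner_eq_zero (hv : LinearIndependent ℝ v) (hν : ‖ν‖ = 1)
    (hperp : ∀ i, ⟪v i, ν⟫ = 0) {w : E (n + 1)} (hw : ⟪w, ν⟫ = 0) :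
    ∃ c : Fin n → ℝ, ∑ i, c i • v i = w := by
  rw [← Submodule.mem_span_range_iff_exists_fun]
  obtain ⟨y, hy, z, hz, rfl⟩ := (Submodule.span ℝ (Set.range v)).exists_add_mem_mem_orthogonal w
  have hz' : ∀ i, ⟪v i, z⟫ = 0 := fun i =>
    Submodule.inner_right_of_mem_orthogonal (Submodule.subset_span (Set.mem_range_self i)) hz
  obtain ⟨c, rfl⟩ := exists_eq_smul_of_inner_eq_zero hv hν hperp hz'
  obtain ⟨b, rfl⟩ := (Submodule.mem_span_range_iff_exists_fun ℝ).1 hy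
  have h1 : c = 0 := by
    simpa [inner_add_left, sum_inner, inner_smul_left, hperp, hν] using hw
  rw [h1, zero_smul, add_zero]
  exact hy

end Hyperplane

/-! ### The flow equation for radial graphs -/

section Flow

variable {n : ℕ}

/-- The outward unit normal of a star-shaped hypersurface is the unit normal with positive radial
component. -/
theorem isOutwardUnitNormal_iff {r : S n → ℝ} {e : OpenPartialHomeomorph (S n) (E n)}
    (he : e ∈ charts n) (hr : ContMDiff (𝓡 n) 𝓘(ℝ, ℝ) 2 r) (hpos : ∀ p, 0 < r p) {u : E n}
    (hu : u ∈ e.target) (ν : E (n + 1)) :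
    IsOutwardUnitNormal (Set.range fun p : S n => r p • (p : E (n + 1)))
        (fun v => r (e.symm v) • param e v) u ν ↔
      ν = graphNormal (param e) (fun v => r (e.symm v)) u := by
  have hT := e.open_target.mem_nhds hu
  have hx : ContDiffAt ℝ 2 (param e) u :=
    ((contDiffOn_param he).contDiffAt hT).of_le (by norm_cast)
  have hf : ContDiffAt ℝ 2 (fun v => r (e.symm v)) u :=
    (contDiffOn_comp_chart_symm he hr).contDiffAt hT
  have hx1 : ∀ v, ‖param e v‖ = 1 := fun v => norm_coe_sphere _
  have hli := linearIndependent_pd_param he hu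
  have hfu : 0 < r (e.symm u) := hpos _
  set ν₀ := graphNormal (param e) (fun v => r (e.symm v)) u with hν₀
  have hnorm : ‖ν₀‖ = 1 := norm_graphNormal hx hx1 hli hfu
  have htan : ∀ i, ⟪pd i (fun v => r (e.symm v) • param e v) u, ν₀⟫ = 0 :=
    inner_pd_graph_graphNormal hx hx1 hli hf
  obtain ⟨hext, hint⟩ := eventually_mem_starExterior_and_starInterior he hr hpos hu hnorm htan
    (inner_self_graphNormal_pos hx hx1 hli hfu)
  constructor
  · rintro ⟨h1, h2, h3⟩
    obtain ⟨c, rfl⟩ := exists_eq_smul_of_inner_eq_zero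
      (linearIndependent_pd_graph hx hx1 hli hf hfu) hnorm htan h2
    rw [norm_smul, hnorm, mul_one, Real.norm_eq_abs] at h1
    -- Only the sign is left to decide; `-ν₀` enters the interior, whose components are bounded.
    rcases eq_or_eq_neg_of_abs_eq h1 with rfl | rfl
    · exact one_smul _ _
    · exfalso
      obtain ⟨s, hs1, hs2⟩ := (h3.and hint).exists
      rw [neg_one_smul] at hs1
      exact hs1 (isBounded_connectedComponentIn_of_mem_starInterior hr.continuous hpos hs2)
  · rintro rfl
    exact ⟨hnorm, htan, hext.mono fun s hs =>
      not_isBounded_connectedComponentIn_of_mem_starExterior hpos hs⟩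

/-- At a point of a radial graph, a normal flow equation up to tangential velocities is a scalar
equation for the radial velocity `d`. -/
theorem exists_tangential_velocity_iff {x : E n → E (n + 1)} {f : E n → ℝ} {u : E n}
    (hx : ContDiffAt ℝ 2 x u) (hx1 : ∀ v, ‖x v‖ = 1)
    (hli : LinearIndependent ℝ fun i => pd i x u) (hf : ContDiffAt ℝ 2 f u) (hpos : 0 < f u)
    (d a b : ℝ) (ζ : E (n + 1)) :
    (∃ c : Fin n → ℝ, d • x u + ∑ i, c i • pd i (fun v => f v • x v) u =
        -(meanCurvature (fun v => f v • x v) (graphNormal x f u) u • graphNormal x f u)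
          + a • f u • x u - b • ζ) ↔
      d = G x f u + a * f u - b * ⟪ζ, x u⟫
        + b * ((∑ k, ⟪pd k x u, ζ⟫ * grad x f u k) / f u) := by
  have hN := gradNormSq_nonneg (f := f) hli
  have hWpos : 0 < √(f u ^ 2 + gradNormSq x f u) := by positivity
  have hnorm := norm_graphNormal hx hx1 hli hpos
  have htan := inner_pd_graph_graphNormal hx hx1 hli hf
  have hsum : ∑ k, ⟪pd k x u, ζ⟫ * grad x f u k = ⟪ζ, gradVec x f u⟫ := by
    rw [inner_gradVec]
    exact Finset.sum_congr rfl fun k _ => by rw [real_inner_comm, mul_comm]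
  have hxν : ⟪x u, graphNormal x f u⟫ = (√(f u ^ 2 + gradNormSq x f u))⁻¹ * f u := by
    rw [graphNormal, inner_smul_right, inner_self_graphNormalVec hx hx1]
  have hζν : ⟪ζ, graphNormal x f u⟫ = (√(f u ^ 2 + gradNormSq x f u))⁻¹ *
      (f u * ⟪ζ, x u⟫ - ⟪ζ, gradVec x f u⟫) := by
    rw [graphNormal, inner_smul_right, graphNormalVec, inner_sub_right, inner_smul_right]
  set w : E (n + 1) :=
    -(meanCurvature (fun v => f v • x v) (graphNormal x f u) u • graphNormal x f u)
      + a • f u • x u - b • ζ - d • x u with hw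
  -- Solvability for `c` means that the discrepancy `w` is tangent, that is, has no normal
  -- component.
  have hexists : (∃ c : Fin n → ℝ, d • x u + ∑ i, c i • pd i (fun v => f v • x v) u =
      -(meanCurvature (fun v => f v • x v) (graphNormal x f u) u • graphNormal x f u)
        + a • f u • x u - b • ζ) ↔ ⟪w, graphNormal x f u⟫ = 0 := by
    constructor
    · rintro ⟨c, hc⟩
      rw [hw, ← hc, add_sub_cancel_left, sum_inner]
      exact Finset.sum_eq_zero fun i _ => by rw [inner_smul_left, htan, mul_zero]
    · intro h
      obtain ⟨c, hc⟩ := exists_sum_smul_eq_of_inner_eq_zero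
        (linearIndependent_pd_graph hx hx1 hli hf hpos) hnorm htan h
      exact ⟨c, by rw [hc, hw]; abel⟩
  have hinner : ⟪w, graphNormal x f u⟫ = (f u / √(f u ^ 2 + gradNormSq x f u)) *
      (G x f u + a * f u - b * ⟪ζ, x u⟫ + b * (⟪ζ, gradVec x f u⟫ / f u) - d) := by
    rw [hw, meanCurvature_graph hx hx1 hli hf hpos]
    simp only [inner_sub_left, inner_add_left, inner_neg_left, real_inner_smul_left, hxν, hζν,
      real_inner_self_eq_norm_sq, hnorm]
    field_simp
    ring
  rw [hexists, hinner, hsum, mul_eq_zero, or_iff_right (by positivity), sub_eq_zero, eq_comm]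

end Flow

end RescaledMCF

end

theorem mainTheorem4 (n : ℕ) (hn : 1 ≤ n)
    (I : Set ℝ) (hI : I.OrdConnected) (hI_nonneg : I ⊆ Set.Ici 0) (hI_zero : (0 : ℝ) ∈ I)
    (hI_nontrivial : I.Nontrivial)
    (lam : ℝ → ℝ) (hlam_pos : ∀ t ∈ I, 0 < lam t) (hlam : DifferentiableOn ℝ lam I)
    (z : ℝ → RescaledMCF.E (n + 1))
    (hz : ContDiffOn ℝ 1 (fun τ => z (RescaledMCF.originalTime I lam τ))
      (RescaledMCF.rescaledInterval I lam))
    (ρ : RescaledMCF.S n → ℝ → ℝ)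
    (hρ_pos : ∀ p, ∀ τ ∈ RescaledMCF.rescaledInterval I lam, 0 < ρ p τ)
    (hρ_space : ∀ τ ∈ RescaledMCF.rescaledInterval I lam,
      ContMDiff (𝓡 n) 𝓘(ℝ, ℝ) 2 (fun p => ρ p τ))
    (hρ_time : ∀ p, DifferentiableOn ℝ (ρ p) (RescaledMCF.rescaledInterval I lam)) :
    RescaledMCF.SatisfiesRescaledMCF I lam z
        (fun p τ => ρ p τ • (p : RescaledMCF.E (n + 1))) ↔
      RescaledMCF.SatisfiesGraphEquation I lam z ρ := by
  refine forall₂_congr fun τ hτ => forall₂_congr fun e he => forall₂_congr fun u hu => ?_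
  have hpos : ∀ p, 0 < ρ p τ := fun p => hρ_pos p τ hτ
  have hT := e.open_target.mem_nhds hu
  -- The direction on the sphere is fixed in time, so the velocity of the parametrization is purely
  -- radial.
  have hderiv : derivWithin (fun τ => ρ (e.symm u) τ • (e.symm u : RescaledMCF.E (n + 1)))
      (RescaledMCF.rescaledInterval I lam) τ =
      derivWithin (ρ (e.symm u)) (RescaledMCF.rescaledInterval I lam) τ •
        RescaledMCF.param e u :=
    derivWithin_smul_const (hρ_time _ τ hτ) _
  rw [← RescaledMCF.exists_tangential_velocity_iff
    (((RescaledMCF.contDiffOn_param he).contDiffAt hT).of_le (by norm_cast))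
    (fun v => RescaledMCF.norm_coe_sphere _) (RescaledMCF.linearIndependent_pd_param he hu)
    ((RescaledMCF.contDiffOn_comp_chart_symm he (hρ_space τ hτ)).contDiffAt hT) (hpos _),
    ← hderiv]
  have hiff := RescaledMCF.isOutwardUnitNormal_iff he (hρ_space τ hτ) hpos hu
  -- Uniqueness of the outward normal removes the quantifier over `ν`, leaving only the one over
  -- `c`.
  constructor
  · rintro ⟨ν, c, hν, hc⟩
    obtain rfl := (hiff ν).1 hν
    exact ⟨c, hc⟩
  · rintro ⟨c, hc⟩
    exact ⟨_, c, (hiff _).2 rfl, hc⟩
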